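/- Let $N$ be the set of positive integers, $P\subseteq N$ the set of prime numbers, and let $P^*$ be the set of nonprincipal ultrafilters on $N$ that contain $P$. For $A,B\subseteq N$ put $AB=\{ab:a\in A,\ b\in B,\ \gcd(a,b)=1\}$, and let $P^{(2)}=PP$ be the set of products of two distinct primes. For ultrafilters $p,q$ on $N$ that contain $P$ let $$F_{1,1}^{p,q}=\{AB:\ A\in p,\ B\in q,\ A,B\subseteq P,\ A\cap B=\emptyset\}.$$ For ultrafilters $x,y$ on $N$ say that $x$ divides $y$ if every $A\in x$ that is upward closed for divisibility (i.e. $a\in A$ and $a\mid n$ imply $n\in A$) belongs to $y$. **Theorem.** For every $p\in P^*$ there is $q\in P^*$ with $q\neq p$ such that exactly $2^{\mathfrak c}$ ultrafilters $r$ on $N$ satisfy $r\supseteq F_{1,1}^{p,q}$. Equivalently, there is $q\in P^*$ with $q\neq p$ such that exactly $2^{\mathfrak c}$ ultrafilters $r$ on $N$ with $P^{(2)}\in r$ are divisible by both $p$ and $q$; indeed, for all distinct $p,q\in P^*$ the ultrafilters on $N$ that contain $F_{1,1}^{p,q}$ are exactly the ultrafilters containing $P^{(2)}$ that are divisible by both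 $p$ and $q$. -/

import Mathlib

namespace UltraDiv

/-- The set `P` of prime numbers, inside the positive integers `N = ℕ+`. -/
def P : Set ℕ+ := {n | n.Prime}

/-- The basic clopen set of all ultrafilters on `N` containing `A`. -/
def clopen (A : Set ℕ+) : Set (Ultrafilter ℕ+) := {x | A ∈ x}

/-- `A* = clopen A \ A`: the nonprincipal ultrafilters containing `A`. The number `n` is identified
with the principal ultrafilter `pure n`. -/
def star (A : Set ℕ+) : Set (Ultrafilter ℕ+) := clopen A \ ((fun n : ℕ+ => (pure n : Ultrafilter ℕ+)) '' A)

/-- The trace `x ↾ A = {X ∩ A : X ∈ x}`. -/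
def trace (x : Ultrafilter ℕ+) (A : Set ℕ+) : Set (Set ℕ+) := {Y | ∃ X ∈ x, Y = X ∩ A}

/-- `A↑`: the set of all multiples of elements of `A`. -/
def multiples (A : Set ℕ+) : Set ℕ+ := {n | ∃ a ∈ A, a ∣ n}

/-- The family of the sets that are upward closed for divisibility. -/
def upClosed : Set (Set ℕ+) := {A | A = multiples A}

/-- Divisibility of ultrafilters: every member of `x` that is upward closed for divisibility
is a member of `y`. -/
def Divides (x y : Ultrafilter ℕ+) : Prop := ∀ A ∈ upClosed, A ∈ x → A ∈ y

/-- The product `AB = {ab : a ∈ A, b ∈ B, gcd(a, b) = 1}`. -/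
def coprimeProd (A B : Set ℕ+) : Set ℕ+ := {n | ∃ a ∈ A, ∃ b ∈ B, PNat.gcd a b = 1 ∧ n = a * b}

/-- `P^(2)`: the products of two distinct primes. -/
def P2 : Set ℕ+ := coprimeProd P P

/-- The family of all `AB` with `A ∈ p ↾ P`, `B ∈ q ↾ P` and `A ∩ B = ∅`. -/
def F11 (p q : Ultrafilter ℕ+) : Set (Set ℕ+) :=
  {S | ∃ A ∈ trace p P, ∃ B ∈ trace q P, A ∩ B = ∅ ∧ S = coprimeProd A B}

/-- The set of the ultrafilters on `N` that contain the family `F`. -/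
def containing (F : Set (Set ℕ+)) : Set (Ultrafilter ℕ+) := {r | ∀ S ∈ F, S ∈ r}

end UltraDiv

/-!
For distinct `p, q ∈ P*` the equality of `containing (F11 p q)` with the set of common multiples of
`p` and `q` in `clopen P2` is elementary: `p` and `q` have disjoint members consisting of primes,
and a product of two primes lying above `A` and above `B`, where `A` and `B` are disjoint sets of
primes, is a product of an element of `A` and an element of `B`.

The substance is the choice of `q`. An ultrafilter `v` on finite sequences of positive integers is
taken such that every coordinate map sends `v` to `p`, while any two coordinate maps differ
`v`-almost everywhere (`exists_ultrafilter_list`); it exists because the members of `p` are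
infinite. Transporting `v` by an injection `e` into the primes outside some member of `p` gives a
`q ≠ p` which is mapped onto `p` by infinitely many essentially different maps. The graph of the
`k`-th map carries an ultrafilter `r k`, the image of `v` under `z ↦ z k * e z`, and it contains
`F11 p q`. Along any ultrafilter `u` on `ℕ` the `r k` have a limit, which also contains `F11 p q`.
As the graphs are disjoint up to null sets, the limit determines `u`
(`graphLimit_injective`). Hence there are at least as many ultrafilters containing `F11 p q` as
ultrafilters on `ℕ`, and of these there are `2 ^ 𝔠` by Hausdorff's independent family
(`two_power_continuum_le_mk_ultrafilter_nat`).
-/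

namespace UltraDiv

open Filter Cardinal

/-! ### The number of ultrafilters on a countable set -/

theorem mk_ultrafilter_le (α : Type) [Countable α] :
    Cardinal.mk (Ultrafilter α) ≤ 2 ^ continuum := by
  have h : Function.Injective (fun u : Ultrafilter α => {A : Set α | A ∈ u}) := by
    intro u v huv
    exact Ultrafilter.ext fun A => Set.ext_iff.1 huv A
  calc Cardinal.mk (Ultrafilter α) ≤ Cardinal.mk (Set (Set α)) := mk_le_of_injective h
    _ = 2 ^ (2 : Cardinal) ^ Cardinal.mk α := by rw [mk_set, mk_set]
    _ ≤ 2 ^ (2 : Cardinal) ^ aleph0 :=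
        power_le_power_left two_ne_zero (power_le_power_left two_ne_zero mk_le_aleph0)
    _ = 2 ^ continuum := by rw [two_power_aleph0]

open Classical in
/-- The member of Hausdorff's independent family of subsets of a countable set that belongs to
`X ⊆ ℕ`: the pairs `(F, 𝓕)` such that the trace of `X` on the finite set `F` belongs to `𝓕`. -/
def hausdorffSet (X : Set ℕ) : Set (Finset ℕ × Finset (Finset ℕ)) :=
  {t | t.1.filter (· ∈ X) ∈ t.2}

/-- Independence of the family `hausdorffSet`: on finitely many indices every pattern of membership
is attained. -/
theorem exists_mem_hausdorffSet_iff (S : Set (Set ℕ)) (T : Finset (Set ℕ)) :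
    ∃ t, ∀ X ∈ T, t ∈ hausdorffSet X ↔ X ∈ S := by
  classical
  have hd : ∀ X Y : Set ℕ, ∃ d, X ≠ Y → ¬(d ∈ X ↔ d ∈ Y) := by
    intro X Y
    by_cases h : X = Y
    · exact ⟨0, fun h' => absurd h h'⟩
    · have : ∃ d, ¬(d ∈ X ↔ d ∈ Y) := by
        by_contra! h'
        exact h (Set.ext h')
      exact this.imp fun d hd _ => hd
  choose d hd using hd
  -- `F` separates the members of `T`, so that they have different traces on it.
  let F := Finset.image₂ d T T
  refine ⟨(F, (T.filter (· ∈ S)).image fun X => F.filter (· ∈ X)), fun X hX => ?_⟩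
  simp only [hausdorffSet, Set.mem_ofPred_eq, Finset.mem_image, Finset.mem_filter]
  constructor
  · rintro ⟨Y, ⟨hY, hYS⟩, hXY⟩
    by_cases h : X = Y
    · rwa [h]
    · have := Finset.ext_iff.1 hXY (d X Y)
      simp only [Finset.mem_filter, F, Finset.mem_image₂_of_mem hX hY, true_and] at this
      exact absurd this.symm (hd X Y h)
  · intro h
    exact ⟨X, ⟨hX, h⟩, rfl⟩

theorem two_power_continuum_le_mk_ultrafilter_nat :
    2 ^ continuum ≤ Cardinal.mk (Ultrafilter ℕ) := by
  classical
  have key : ∀ S : Set (Set ℕ), ∃ u : Ultrafilter (Finset ℕ × Finset (Finset ℕ)),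
      ∀ X, hausdorffSet X ∈ u ↔ X ∈ S := by
    intro S
    let B : Set ℕ → Set (Finset ℕ × Finset (Finset ℕ)) := fun X =>
      {t | t ∈ hausdorffSet X ↔ X ∈ S}
    obtain ⟨u, hu⟩ := Ultrafilter.exists_ultrafilter_of_finite_inter_nonempty (Set.range B) (by
      intro T hT
      rw [← Set.image_univ] at hT
      obtain ⟨T', -, rfl⟩ := Finset.subset_set_image_iff.1 hT
      obtain ⟨t, ht⟩ := exists_mem_hausdorffSet_iff S T'
      refine ⟨t, ?_⟩
      simpa [B] using ht)
    refine ⟨u, fun X => ?_⟩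
    have hX : B X ∈ u := hu ⟨X, rfl⟩
    by_cases h : X ∈ S
    · simpa [B, h] using hX
    · have : (hausdorffSet X)ᶜ ∈ u := by simpa [B, h, Set.compl_def] using hX
      simpa [h] using Ultrafilter.compl_mem_iff_notMem.1 this
  choose u hu using key
  have hinj : Function.Injective
      (fun S => (u S).map (Encodable.encode : Finset ℕ × Finset (Finset ℕ) → ℕ)) := by
    intro S S' h
    have h' : u S = u S' :=
      Ultrafilter.coe_injective
        (Filter.map_injective Encodable.encode_injective (congrArg Ultrafilter.toFilter h))
    ext X
    rw [← hu S, ← hu S', h']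
  have := mk_le_of_injective hinj
  rwa [mk_set, mk_set, mk_nat, two_power_aleph0] at this

/-! ### An ultrafilter with infinitely many maps onto a given one -/

/-- There is an ultrafilter on finite sequences all of whose coordinates are distributed like `p`,
and whose coordinates are pairwise distinct almost everywhere. The default value `a` for the
coordinates beyond the end of a sequence is immaterial: the `k`-th and `(k + 1)`-st coordinates
agree on sequences of length at most `k`, so these sequences form a null set. -/
theorem exists_ultrafilter_list {α : Type*} (a : α) (p : Ultrafilter α)
    (hp : ∀ A ∈ p, A.Infinite) :
    ∃ v : Ultrafilter (List α),
      (∀ k, ∀ A ∈ p, {z : List α | z.getD k a ∈ A} ∈ v) ∧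
      ∀ j k, j < k → {z : List α | z.getD j a ≠ z.getD k a} ∈ v := by
  let T : ℕ × {A // A ∈ p} → Set (List α) := fun i =>
    {z | ∀ k < i.1, z.getD k a ∈ i.2.1 ∧ ∀ j < k, z.getD j a ≠ z.getD k a}
  have : Nonempty (ℕ × {A // A ∈ p}) := ⟨(0, ⟨Set.univ, univ_mem⟩)⟩
  have hne : (⨅ i, 𝓟 (T i)).NeBot := by
    refine iInf_neBot_of_directed' ?_ ?_
    · rintro ⟨m, A, hA⟩ ⟨n, B, hB⟩
      refine ⟨(max m n, ⟨A ∩ B, inter_mem hA hB⟩), ?_, ?_⟩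
      · exact principal_mono.2 fun z hz k hk =>
          ⟨(hz k (lt_max_of_lt_left hk)).1.1, (hz k (lt_max_of_lt_left hk)).2⟩
      · exact principal_mono.2 fun z hz k hk =>
          ⟨(hz k (lt_max_of_lt_right hk)).1.2, (hz k (lt_max_of_lt_right hk)).2⟩
    · rintro ⟨n, A, hA⟩
      rw [principal_neBot_iff]
      let f := (hp A hA).natEmbedding
      have hf : ∀ k < n, ((List.range n).map fun i => (f i : α)).getD k a = f k := by
        intro k hk
        simp [List.getD, hk]
      refine ⟨(List.range n).map fun i => (f i : α), fun k hk => ⟨?_, fun j hj => ?_⟩⟩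
      · rw [hf k hk]
        exact (f k).2
      · rw [hf k hk, hf j (hj.trans hk)]
        exact fun h => hj.ne (f.injective (Subtype.ext h))
  have hT : ∀ i, T i ∈ Ultrafilter.of (⨅ i, 𝓟 (T i)) := fun i =>
    Ultrafilter.of_le _ (mem_iInf_of_mem i (mem_principal_self _))
  refine ⟨Ultrafilter.of (⨅ i, 𝓟 (T i)), fun k A hA => ?_, fun j k hjk => ?_⟩
  · exact mem_of_superset (hT (k + 1, ⟨A, hA⟩)) fun z hz => (hz k k.lt_succ_self).1
  · exact mem_of_superset (hT (k + 1, ⟨Set.univ, univ_mem⟩)) fun z hz =>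
      (hz k k.lt_succ_self).2 j hjk

/-! ### Sets of primes and their products -/

theorem eq_of_mem_P_of_dvd {a b : ℕ+} (ha : a ∈ P) (hb : b ∈ P) (h : a ∣ b) : a = b := by
  rcases (PNat.dvd_prime hb).1 h with h | h
  · exact absurd h (PNat.Prime.ne_one ha)
  · exact h

theorem eq_or_eq_of_mem_P_of_dvd_mul {a b c : ℕ+} (ha : a ∈ P) (hb : b ∈ P) (hc : c ∈ P)
    (h : a ∣ b * c) : a = b ∨ a = c := by
  rw [PNat.dvd_iff, PNat.mul_coe] at h
  rcases (Nat.Prime.dvd_mul ha).1 h with h | h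
  · exact Or.inl (eq_of_mem_P_of_dvd ha hb (PNat.dvd_iff.2 h))
  · exact Or.inr (eq_of_mem_P_of_dvd ha hc (PNat.dvd_iff.2 h))

theorem gcd_eq_one_of_mem_P {a b : ℕ+} (ha : a ∈ P) (hb : b ∈ P) (h : a ≠ b) :
    PNat.gcd a b = 1 := by
  refine PNat.coprime_coe.1 ((Nat.coprime_primes ha hb).2 ?_)
  exact fun h' => h (PNat.eq h')

theorem mul_mem_coprimeProd {A B : Set ℕ+} (hA : A ⊆ P) (hB : B ⊆ P) (hAB : A ∩ B = ∅)
    {a b : ℕ+} (ha : a ∈ A) (hb : b ∈ B) : a * b ∈ coprimeProd A B := by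
  refine ⟨a, ha, b, hb, gcd_eq_one_of_mem_P (hA ha) (hB hb) ?_, rfl⟩
  rintro rfl
  exact Set.notMem_empty a (hAB ▸ ⟨ha, hb⟩)

theorem coprimeProd_mono {A B C D : Set ℕ+} (hAC : A ⊆ C) (hBD : B ⊆ D) :
    coprimeProd A B ⊆ coprimeProd C D := by
  rintro n ⟨a, ha, b, hb, h⟩
  exact ⟨a, hAC ha, b, hBD hb, h⟩

theorem P2_inter_multiples_subset {A B : Set ℕ+} (hA : A ⊆ P) (hB : B ⊆ P) (hAB : A ∩ B = ∅) :
    P2 ∩ (multiples A ∩ multiples B) ⊆ coprimeProd A B := by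
  rintro n ⟨⟨c, hc, d, hd, -, rfl⟩, ⟨a, ha, han⟩, ⟨b, hb, hbn⟩⟩
  have hab : a ≠ b := by
    rintro rfl
    exact Set.notMem_empty a (hAB ▸ ⟨ha, hb⟩)
  rcases eq_or_eq_of_mem_P_of_dvd_mul (hA ha) hc hd han with rfl | rfl <;>
    rcases eq_or_eq_of_mem_P_of_dvd_mul (hB hb) hc hd hbn with rfl | rfl
  · exact absurd rfl hab
  · exact mul_mem_coprimeProd hA hB hAB ha hb
  · rw [mul_comm]
    exact mul_mem_coprimeProd hA hB hAB ha hb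
  · exact absurd rfl hab

theorem subset_multiples (A : Set ℕ+) : A ⊆ multiples A := fun a ha => ⟨a, ha, dvd_rfl⟩

theorem multiples_mem_upClosed (A : Set ℕ+) : multiples A ∈ upClosed := by
  refine Set.Subset.antisymm (subset_multiples _) ?_
  rintro n ⟨m, ⟨a, ha, ham⟩, hmn⟩
  exact ⟨a, ha, ham.trans hmn⟩

theorem mem_of_mem_upClosed {A : Set ℕ+} (hA : A ∈ upClosed) {a n : ℕ+} (ha : a ∈ A)
    (h : a ∣ n) : n ∈ A := by
  have hA' : A = multiples A := hA
  rw [hA']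
  exact ⟨a, ha, h⟩

/-! ### Ultrafilters containing `F11 p q` and common multiples of `p` and `q` -/

theorem containing_F11_eq {p q : Ultrafilter ℕ+} (hp : P ∈ p) (hq : P ∈ q) (hqp : q ≠ p) :
    containing (F11 p q) = {r | r ∈ clopen P2 ∧ Divides p r ∧ Divides q r} := by
  ext r
  constructor
  · intro hr
    obtain ⟨X, hX, hXq⟩ : ∃ X ∈ p, X ∉ q := by
      by_contra! h
      exact hqp (Ultrafilter.eq_of_le fun A hA => h A hA)
    have hYq : Xᶜ ∈ q := Ultrafilter.compl_mem_iff_notMem.2 hXq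
    have hmem : ∀ C ∈ p, ∀ D ∈ q, coprimeProd (C ∩ X ∩ P) (D ∩ Xᶜ ∩ P) ∈ r := by
      intro C hC D hD
      refine hr _ ⟨_, ⟨_, inter_mem hC hX, rfl⟩, _, ⟨_, inter_mem hD hYq, rfl⟩, ?_, rfl⟩
      ext a
      simp only [Set.mem_inter_iff, Set.mem_compl_iff, Set.mem_empty_iff_false, iff_false]
      tauto
    refine ⟨?_, fun C hC hCp => ?_, fun D hD hDq => ?_⟩
    · exact mem_of_superset (hmem _ hp _ hq)
        (coprimeProd_mono Set.inter_subset_right Set.inter_subset_right)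
    · refine mem_of_superset (hmem C hCp _ hq) ?_
      rintro n ⟨a, ha, b, -, -, rfl⟩
      exact mem_of_mem_upClosed hC ha.1.1 (dvd_mul_right a b)
    · refine mem_of_superset (hmem _ hp D hDq) ?_
      rintro n ⟨a, -, b, hb, -, rfl⟩
      exact mem_of_mem_upClosed hD hb.1.1 (dvd_mul_left b a)
  · rintro ⟨hr, hpr, hqr⟩ S ⟨A, ⟨X, hX, rfl⟩, B, ⟨Y, hY, rfl⟩, hAB, rfl⟩
    refine mem_of_superset (inter_mem hr (inter_mem ?_ ?_)) (P2_inter_multiples_subset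
      Set.inter_subset_right Set.inter_subset_right hAB)
    · exact hpr _ (multiples_mem_upClosed _)
        (mem_of_superset (inter_mem hX hp) (subset_multiples _))
    · exact hqr _ (multiples_mem_upClosed _)
        (mem_of_superset (inter_mem hY hq) (subset_multiples _))

theorem infinite_P : P.Infinite := by
  refine Set.infinite_of_injective_forall_mem (f := fun p : Nat.Primes => (⟨p, p.2.pos⟩ : ℕ+))
    (fun a b h => ?_) (fun a => a.2)
  exact Subtype.ext (congrArg PNat.val h)

theorem mem_star_P_iff {p : Ultrafilter ℕ+} : p ∈ star P ↔ P ∈ p ∧ ∀ A ∈ p, A.Infinite := by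
  refine and_congr_right fun (hp : P ∈ p) => ⟨fun h A hA hfin => ?_, ?_⟩
  · obtain ⟨a, ha, rfl⟩ := Ultrafilter.eq_pure_of_finite_mem (hfin.inter_of_left P)
      (inter_mem hA hp)
    exact h ⟨a, ha.2, rfl⟩
  · rintro h ⟨a, -, rfl⟩
    exact h {a} rfl (Set.finite_singleton a)

/-- An ultrafilter containing `P` has a member that misses infinitely many primes, since it decides
between two infinite halves of `P`. -/
theorem exists_mem_infinite_diff {p : Ultrafilter ℕ+} (hp : P ∈ p) :
    ∃ A ∈ p, A ⊆ P ∧ (P \ A).Infinite := by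
  obtain ⟨A, B, hAB, hdis, hcard⟩ := infinite_P.exists_union_disjoint_cardinal_eq_of_infinite
  have hfin : A.Finite ↔ B.Finite := by
    rw [← lt_aleph0_iff_set_finite, ← lt_aleph0_iff_set_finite, hcard]
  have hA : A.Infinite := fun h => infinite_P (hAB ▸ h.union (hfin.1 h))
  have hB : B.Infinite := fun h => hA (hfin.2 h)
  rw [← hAB] at hp ⊢
  rcases Ultrafilter.union_mem_iff.1 hp with h | h
  · exact ⟨A, h, Set.subset_union_left, by rwa [Set.union_sdiff_cancel_left hdis.le_bot]⟩
  · exact ⟨B, h, Set.subset_union_right, by rwa [Set.union_sdiff_cancel_right hdis.le_bot]⟩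

/-! ### Limits of graphs -/

/-- The limit along `u` of the images of `v` under the maps `z ↦ z k * e z`. As a product of
distinct primes stands for a pair of primes, the `k`-th image is the ultrafilter carried by the
graph of the `k`-th coordinate, with `z` encoded as `e z`. -/
def graphLimit (v : Ultrafilter (List ℕ+)) (e : List ℕ+ → ℕ+) (u : Ultrafilter ℕ) :
    Ultrafilter ℕ+ :=
  u.bind fun k => v.map fun z => z.getD k 1 * e z

theorem mem_graphLimit {v : Ultrafilter (List ℕ+)} {e : List ℕ+ → ℕ+} {u : Ultrafilter ℕ}
    {S : Set ℕ+} : S ∈ graphLimit v e u ↔ {k | {z | z.getD k 1 * e z ∈ S} ∈ v} ∈ u :=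
  Iff.rfl

theorem graphLimit_mem_containing {p : Ultrafilter ℕ+} {v : Ultrafilter (List ℕ+)}
    {e : List ℕ+ → ℕ+}
    (hv : ∀ k, ∀ A ∈ p, {z : List ℕ+ | z.getD k 1 ∈ A} ∈ v) (hp : P ∈ p) (he : ∀ z, e z ∈ P)
    (u : Ultrafilter ℕ) : graphLimit v e u ∈ containing (F11 p (v.map e)) := by
  rintro S ⟨A, ⟨X, hX, rfl⟩, B, ⟨Y, hY, rfl⟩, hAB, rfl⟩
  refine mem_graphLimit.2 (univ_mem' fun k => ?_)
  filter_upwards [hv k _ (inter_mem hX hp), Ultrafilter.mem_map.1 hY] with z hz hz'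
  exact mul_mem_coprimeProd Set.inter_subset_right Set.inter_subset_right hAB hz ⟨hz', he z⟩

/-- The ultrafilter `u` is recovered from `graphLimit v e u`: the graphs, made disjoint by removing
from each the null part that meets the earlier ones, index a partition of the set of products, and
`u` is the image of the limit under the map to the index. -/
theorem graphLimit_injective {p : Ultrafilter ℕ+} {v : Ultrafilter (List ℕ+)}
    {e : List ℕ+ → ℕ+} {A : Set ℕ+}
    (hv : ∀ k, ∀ A ∈ p, {z : List ℕ+ | z.getD k 1 ∈ A} ∈ v)
    (hne : ∀ j k, j < k → {z : List ℕ+ | z.getD j 1 ≠ z.getD k 1} ∈ v)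
    (hA : A ∈ p) (hAP : A ⊆ P) (he : ∀ z, e z ∈ P \ A) (hinj : Function.Injective e) :
    Function.Injective (graphLimit v e) := by
  -- The part of the `k`-th graph that lies over `A` and outside the earlier graphs.
  let G : Set ℕ → Set ℕ+ := fun W => {n | ∃ k ∈ W, ∃ z : List ℕ+, n = z.getD k 1 * e z ∧
    z.getD k 1 ∈ A ∧ ∀ j < k, z.getD j 1 ≠ z.getD k 1}
  have hmem : ∀ (u : Ultrafilter ℕ) (W : Set ℕ), W ∈ u → G W ∈ graphLimit v e u := by
    intro u W hW
    refine mem_graphLimit.2 (mem_of_superset hW fun k hk => ?_)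
    have hlt : ∀ᶠ z in (v : Filter (List ℕ+)), ∀ j ∈ Set.Iio k, z.getD j 1 ≠ z.getD k 1 :=
      (eventually_all_finite (Set.finite_Iio k)).2 fun j hj => hne j k hj
    filter_upwards [hv k A hA, hlt] with z hz hz'
    exact ⟨k, hk, z, rfl, hz, hz'⟩
  have hdisj : ∀ W, G W ∩ G Wᶜ = ∅ := by
    intro W
    rw [Set.eq_empty_iff_forall_notMem]
    rintro n ⟨⟨k, hk, z, rfl, hz, hkz⟩, l, hl, z', heq, hz', hlz⟩
    -- The factor in `A` and the factor outside `A` can be read off from the product.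
    have h1 : z.getD k 1 = z'.getD l 1 := by
      rcases eq_or_eq_of_mem_P_of_dvd_mul (hAP hz) (hAP hz') (he z').1
        (heq ▸ dvd_mul_right _ _) with h | h
      · exact h
      · exact absurd (h ▸ hz) (he z').2
    have h2 : z = z' := by
      rw [h1] at heq
      exact hinj (mul_left_cancel heq)
    subst h2
    rcases lt_trichotomy k l with h | h | h
    · exact hlz k h h1
    · exact hl (h ▸ hk)
    · exact hkz l h h1.symm
  intro u u' huu
  refine (Ultrafilter.eq_of_le fun W hW => ?_).symm
  by_contra hW'
  have h1 := hmem u W hW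
  rw [huu] at h1
  have h2 := inter_mem h1 (hmem u' _ (Ultrafilter.compl_mem_iff_notMem.2 hW'))
  rw [hdisj] at h2
  exact Ultrafilter.empty_notMem h2

theorem exists_mk_containing_F11_eq {p : Ultrafilter ℕ+} (hp : p ∈ star P) :
    ∃ q ∈ star P, q ≠ p ∧ Cardinal.mk (containing (F11 p q)) = 2 ^ continuum := by
  obtain ⟨hP, hinf⟩ := mem_star_P_iff.1 hp
  obtain ⟨A, hA, hAP, hB⟩ := exists_mem_infinite_diff hP
  obtain ⟨v, hv, hne⟩ := exists_ultrafilter_list 1 p hinf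
  let f := hB.natEmbedding
  let e : List ℕ+ → ℕ+ := fun z => f (Encodable.encode z)
  have he : ∀ z, e z ∈ P \ A := fun z => (f _).2
  have hinj : Function.Injective e := fun z z' h =>
    Encodable.encode_injective (f.injective (Subtype.ext h))
  refine ⟨v.map e, mem_star_P_iff.2 ⟨Ultrafilter.mem_map.2 (univ_mem' fun z => (he z).1),
    fun B hBv hfin => ?_⟩, ?_, ?_⟩
  · -- A finite member would make `v`, hence its image `p` under a coordinate, principal.
    have hfin' := (hfin.preimage hinj.injOn).image fun z => z.getD 0 1
    refine hinf _ ?_ hfin'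
    by_contra h
    obtain ⟨z, hz, hz'⟩ := Ultrafilter.nonempty_of_mem
      (inter_mem (Ultrafilter.mem_map.1 hBv) (hv 0 _ (Ultrafilter.compl_mem_iff_notMem.2 h)))
    exact hz' ⟨z, hz, rfl⟩
  · intro h
    rw [← h] at hA
    obtain ⟨z, hz⟩ := Ultrafilter.nonempty_of_mem (Ultrafilter.mem_map.1 hA)
    exact (he z).2 hz
  · refine le_antisymm ((mk_set_le _).trans (mk_ultrafilter_le ℕ+)) ?_
    refine two_power_continuum_le_mk_ultrafilter_nat.trans ?_
    refine mk_le_of_injective (f := fun u => (⟨graphLimit v e u,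
      graphLimit_mem_containing hv hP (fun z => (he z).1) u⟩ : containing (F11 p (v.map e)))) ?_
    intro u u' h
    exact graphLimit_injective hv hne hA hAP he hinj (congrArg Subtype.val h)

end UltraDiv

theorem mainTheorem5 (p : Ultrafilter ℕ+) (hp : p ∈ UltraDiv.star UltraDiv.P) :
    (∀ q ∈ UltraDiv.star UltraDiv.P, q ≠ p →
      UltraDiv.containing (UltraDiv.F11 p q) =
        {r | r ∈ UltraDiv.clopen UltraDiv.P2 ∧ UltraDiv.Divides p r ∧ UltraDiv.Divides q r}) ∧
    ∃ q ∈ UltraDiv.star UltraDiv.P, q ≠ p ∧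
      Cardinal.mk (UltraDiv.containing (UltraDiv.F11 p q)) = 2 ^ Cardinal.continuum ∧
      Cardinal.mk {r : Ultrafilter ℕ+ | r ∈ UltraDiv.clopen UltraDiv.P2 ∧
        UltraDiv.Divides p r ∧ UltraDiv.Divides q r} = 2 ^ Cardinal.continuum := by
  refine ⟨fun q hq hqp => UltraDiv.containing_F11_eq hp.1 hq.1 hqp, ?_⟩
  obtain ⟨q, hq, hqp, hcard⟩ := UltraDiv.exists_mk_containing_F11_eq hp
  refine ⟨q, hq, hqp, hcard, ?_⟩
  rw [← UltraDiv.containing_F11_eq hp.1 hq.1 hqp]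
  exact hcard
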